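/- Let $m\ge 1$ and $k\ge 0$ be integers. For a continuous function $g:\mathbb{R}^{m+1}\setminus\{0\}\to\mathbb{R}$ define its extended spherical Radon transform by $$\mathcal{R}[g](Z):=\frac{1}{|Z|\,\mathscr{H}^{m-1}(\mathbb{S}^{m-1})}\int_{\mathbb{S}^m\cap Z^\perp} g(\omega)\,d\mathscr{H}^{m-1}(\omega),\qquad Z\in\mathbb{R}^{m+1}\setminus\{0\},$$ where $\mathscr{H}^{m-1}$ is the $(m-1)$-dimensional Hausdorff measure, $\mathbb{S}^m$ is the unit sphere of $\mathbb{R}^{m+1}$, and $Z^\perp$ is the hyperplane orthogonal to $Z$. Let $g\in C^k(\mathbb{R}^{m+1}\setminus\{0\})$ be positively $(-m)$-homogeneous, i.e. $g(ty)=t^{-m}g(y)$ for all $t>0$ and all $y\neq 0$. Then $\mathcal{R}[g]\in C^k(\mathbb{R}^{m+1}\setminus\{0\})$, and for all indices $\tau_1,\dots,\tau_k,\sigma_1,\dots,\sigma_k\in\{1,\dots,m+1\}$ and all $Z=(Z_1,\dots,Z_{m+1})\in\mathbb{R}^{m+1}\setminus\{0\}$, $$Z_{\tau_1}\cdots Z_{\tau_k}\,\frac{\partial}{\partial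 Z_{\sigma_1}}\cdots\frac{\partial}{\partial Z_{\sigma_k}}\mathcal{R}[g](Z)=(-1)^k\,\mathcal{R}\Big[\frac{\partial}{\partial y_{\tau_1}}\cdots\frac{\partial}{\partial y_{\tau_k}}\big(y_{\sigma_1}\cdots y_{\sigma_k}\,g(y)\big)\Big](Z).$$ -/

import Mathlib

open MeasureTheory

noncomputable section

/-- The spherical Radon transform on the unit sphere `S^m ⊆ ℝ^(m+1)`: the integral of `f` over the
great subsphere `S^m ∩ ζ^⊥` with respect to the `(m-1)`-dimensional Hausdorff measure, divided by
the `(m-1)`-dimensional Hausdorff measure of `S^(m-1) ⊆ ℝ^m`. Only the values of `f` on the unit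
sphere matter; the definition is meant for `m ≥ 1` and `‖ζ‖ = 1`. -/
def sphericalRadon (m : ℕ) (f : EuclideanSpace ℝ (Fin (m + 1)) → ℝ)
    (ζ : EuclideanSpace ℝ (Fin (m + 1))) : ℝ :=
  (μHE[m - 1].real (Metric.sphere (0 : EuclideanSpace ℝ (Fin m)) 1))⁻¹ *
    ∫ ω in Metric.sphere (0 : EuclideanSpace ℝ (Fin (m + 1))) 1 ∩ {ω | inner ℝ ζ ω = 0},
      f ω ∂μHE[m - 1]

/-- The extended spherical Radon transform
`R[g](Z) = |Z|⁻¹ * (spherical Radon transform of g restricted to S^m)(Z / |Z|)`, for `Z ≠ 0`. -/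
def extendedRadon (m : ℕ) (g : EuclideanSpace ℝ (Fin (m + 1)) → ℝ)
    (Z : EuclideanSpace ℝ (Fin (m + 1))) : ℝ :=
  ‖Z‖⁻¹ * sphericalRadon m g (‖Z‖⁻¹ • Z)

/-- The partial derivative of `f` in the `i`-th standard coordinate. -/
def partialDeriv {n : ℕ} (i : Fin n) (f : EuclideanSpace ℝ (Fin n) → ℝ) :
    EuclideanSpace ℝ (Fin n) → ℝ :=
  fun y => fderiv ℝ f y (EuclideanSpace.single i 1)

/-- The iterated partial derivative; for the list `[i₁, …, iₖ]` it is `∂_{i₁} (∂_{i₂} (⋯ ∂_{iₖ} f))`.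
-/
def iteratedPartialDeriv {n : ℕ} :
    List (Fin n) → (EuclideanSpace ℝ (Fin n) → ℝ) → EuclideanSpace ℝ (Fin n) → ℝ
  | [], f => f
  | i :: l, f => partialDeriv i (iteratedPartialDeriv l f)

end

/-! The derivative of `extendedRadon` comes from moving the great subsphere by reflections. For Z'
near Z, the reflection in the hyperplane orthogonal to |Z'|Z + |Z|Z' carries the line of Z to that
of Z' (`householder_add_smul`) and preserves Hausdorff measure. The integral over a moving subsphere
thus becomes one over a fixed subsphere with a moving integrand, and differentiation under the
integral sign gives |Z|² ∂_s R[g](Z) = -R[∂_Z(y_s g)](Z), without homogeneity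
(`exists_hasFDerivAt_extendedRadon`).

Homogeneity removes the tangential part: if W ⟂ Z and h has degree -m + 1, then ∂_W h integrates to
zero over the subsphere (`setIntegral_subsphere_fderiv_eq_zero`), a divergence theorem deduced from
rotation invariance. Splitting the coordinate vector of index t into its components along Z and Z^⊥
yields the case k = 1: Z_t ∂_s R[g] = -R[∂_t(y_s g)].

As ∂_t(y_s g) is again of degree -m and loses one derivative, this case can be iterated. It gives
smoothness by induction, and then the general formula: the Leibniz terms from ∂_s acting on
Z_{τ₁}⋯Z_{τₖ} match the commutator terms of y_s with the derivatives indexed by τ. -/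

section RadonAux

open Set Metric Topology Filter

/-! ### Finiteness of the Hausdorff measure of spheres and great subspheres. -/

section Finiteness

variable {V : Type*} [NormedAddCommGroup V] [InnerProductSpace ℝ V] [FiniteDimensional ℝ V]
  [MeasurableSpace V] [BorelSpace V]

omit [FiniteDimensional ℝ V] [MeasurableSpace V] [BorelSpace V] in
/-- A unit vector in the closed half space `⟪v, x⟫ ≤ 0` is the inverse stereographic image, from
the pole `v`, of a point of the closed ball of radius `2`. -/
theorem exists_stereoInvFunAux_eq {v x : V} (hv : ‖v‖ = 1) (hx : ‖x‖ = 1)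
    (h : inner ℝ v x ≤ 0) :
    ∃ w : (ℝ ∙ v)ᗮ, w ∈ closedBall (0 : (ℝ ∙ v)ᗮ) 2 ∧ stereoInvFunAux v (w : V) = x := by
  have hxv : x ≠ v := by
    rintro rfl
    rw [real_inner_self_eq_norm_sq, hx] at h
    norm_num at h
  have hs := stereo_left_inv hv (x := ⟨x, by simpa using hx⟩) hxv
  refine ⟨stereoToFun v x, ?_, congrArg Subtype.val hs⟩
  have hproj : ‖(ℝ ∙ v)ᗮ.orthogonalProjectionOnto x‖ ≤ 1 :=
    ((ℝ ∙ v)ᗮ.norm_orthogonalProjectionOnto_apply_le x).trans hx.le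
  -- In the half space ⟪v, x⟫ ≤ 0 the denominator is at least 1; this is the source of the radius 2.
  have h2 : |2 / (1 - inner ℝ v x)| ≤ 2 := by
    rw [abs_of_pos (by apply div_pos <;> linarith), div_le_iff₀ (by linarith)]
    linarith
  rw [mem_closedBall_zero_iff, stereoToFun_apply, norm_smul, innerSL_apply_apply, Real.norm_eq_abs]
  calc _ ≤ 2 * 1 := mul_le_mul h2 hproj (norm_nonneg _) (by norm_num)
    _ = 2 := by norm_num

/-- A C¹ map is Lipschitz on a compact convex ball, so it sends that ball, of finite measure in
dimension n, to a set of finite n-dimensional measure. -/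
theorem euclideanHausdorffMeasure_image_stereoInvFunAux_lt_top {n : ℕ}
    (hn : Module.finrank ℝ V = n + 1) {v : V} (hv : ‖v‖ = 1) :
    μHE[n] ((fun w : (ℝ ∙ v)ᗮ => stereoInvFunAux v (w : V)) '' closedBall 0 2) < ⊤ := by
  have hrank : Module.finrank ℝ (ℝ ∙ v)ᗮ = n := by
    have : Fact (Module.finrank ℝ V = n + 1) := ⟨hn⟩
    exact Submodule.finrank_orthogonal_span_singleton (by rintro rfl; simp at hv)
  have hsm : ContDiff ℝ 1 (fun w : (ℝ ∙ v)ᗮ => stereoInvFunAux v (w : V)) :=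
    contDiff_stereoInvFunAux.comp (ℝ ∙ v)ᗮ.subtypeL.contDiff
  obtain ⟨K, hK⟩ := hsm.contDiffOn.exists_lipschitzOnWith one_ne_zero
    (convex_closedBall (0 : (ℝ ∙ v)ᗮ) 2) (isCompact_closedBall 0 2)
  have hle := hK.hausdorffMeasure_image_le (d := n) (by positivity)
  have hfin : μHE[n] (closedBall (0 : (ℝ ∙ v)ᗮ) 2) < ⊤ := by
    rw [← hrank]
    exact measure_closedBall_lt_top
  -- The Lipschitz bound concerns `μH`. Finiteness passes from `μHE` to `μH` and back because they
  -- differ by a finite nonzero factor.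
  rw [Measure.euclideanHausdorffMeasure_def, Measure.smul_apply] at hfin ⊢
  have hc := Measure.addHaarScalarFactor_volume_hausdorffMeasure_ne_zero n
  rw [ENNReal.smul_def, smul_eq_mul] at hfin ⊢
  have hfin' : μH[n] (closedBall (0 : (ℝ ∙ v)ᗮ) 2) < ⊤ := by
    rcases ENNReal.mul_lt_top_iff.1 hfin with h | h | h
    · exact h.2
    · exact absurd (by simpa using h) hc
    · rw [h]; exact ENNReal.zero_lt_top
  refine ENNReal.mul_lt_top ENNReal.coe_lt_top (hle.trans_lt ?_)
  exact ENNReal.mul_lt_top (by simp) hfin'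

/-- The unit sphere of an `(n + 1)`-dimensional space has finite `n`-dimensional measure. -/
theorem euclideanHausdorffMeasure_sphere_lt_top {n : ℕ} (hn : Module.finrank ℝ V = n + 1) :
    μHE[n] (sphere (0 : V) 1) < ⊤ := by
  have : Nontrivial V := Module.nontrivial_of_finrank_pos (R := ℝ) (by omega)
  obtain ⟨v, hv⟩ := exists_norm_eq V zero_le_one
  have hsub : sphere (0 : V) 1 ⊆
      (fun w : (ℝ ∙ v)ᗮ => stereoInvFunAux v (w : V)) '' closedBall 0 2 ∪
      (fun w : (ℝ ∙ (-v))ᗮ => stereoInvFunAux (-v) (w : V)) '' closedBall 0 2 := by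
    intro x hx
    rw [mem_sphere_zero_iff_norm] at hx
    rcases le_total (inner ℝ v x) 0 with h | h
    · exact Or.inl (exists_stereoInvFunAux_eq hv hx h)
    · exact Or.inr (exists_stereoInvFunAux_eq (by simpa using hv) hx (by simpa using h))
  refine (measure_mono hsub).trans_lt ((measure_union_le _ _).trans_lt (ENNReal.add_lt_top.2 ⟨?_, ?_⟩))
  · exact euclideanHausdorffMeasure_image_stereoInvFunAux_lt_top hn hv
  · exact euclideanHausdorffMeasure_image_stereoInvFunAux_lt_top hn (by simpa using hv)

/-- The unit sphere of the hyperplane `Z^⊥`. -/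
def subsphere (Z : V) : Set V := sphere (0 : V) 1 ∩ {ω | inner ℝ Z ω = 0}

omit [FiniteDimensional ℝ V] [MeasurableSpace V] [BorelSpace V] in
theorem mem_subsphere {Z ω : V} : ω ∈ subsphere Z ↔ ‖ω‖ = 1 ∧ inner ℝ Z ω = 0 := by
  simp [subsphere]

omit [FiniteDimensional ℝ V] [MeasurableSpace V] [BorelSpace V] in
theorem ne_zero_of_mem_subsphere {Z ω : V} (h : ω ∈ subsphere Z) : ω ≠ 0 := by
  rintro rfl
  simp [mem_subsphere] at h

omit [MeasurableSpace V] [BorelSpace V] in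
theorem isCompact_subsphere (Z : V) : IsCompact (subsphere Z) :=
  (isCompact_sphere 0 1).inter_right (isClosed_eq (by fun_prop) (by fun_prop))

theorem euclideanHausdorffMeasure_subsphere_lt_top {n : ℕ} (hn : Module.finrank ℝ V = n + 2)
    {Z : V} (hZ : Z ≠ 0) : μHE[n] (subsphere Z) < ⊤ := by
  have hrank : Module.finrank ℝ (ℝ ∙ Z)ᗮ = n + 1 := by
    have : Fact (Module.finrank ℝ V = (n + 1) + 1) := ⟨hn⟩
    exact Submodule.finrank_orthogonal_span_singleton hZ
  have himg : subsphere Z = (Subtype.val : (ℝ ∙ Z)ᗮ → V) '' sphere 0 1 := by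
    ext x
    simp [mem_subsphere, Submodule.mem_orthogonal_singleton_iff_inner_right, and_comm]
  rw [himg, (isometry_subtype_coe).euclideanHausdorffMeasure_image]
  exact euclideanHausdorffMeasure_sphere_lt_top hrank

end Finiteness

/-! ### Continuity and differentiation of integrals over a compact set. -/

section Parametric

variable {X E : Type*} [NormedAddCommGroup X] [NormedSpace ℝ X] [NormedAddCommGroup E]
  [MeasurableSpace E] [BorelSpace E] {μ : Measure E} {S : Set E} {O : Set (X × E)} {x₀ : X}

omit [NormedSpace ℝ X] [MeasurableSpace E] [BorelSpace E] in
/-- A function continuous on a neighbourhood of `{x₀} ×ˢ S`, with `S` compact, is bounded on a tube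
around it. -/
theorem exists_tube_norm_le {G : Type*} [NormedAddCommGroup G] {F : X × E → G} (hS : IsCompact S)
    (hO : IsOpen O) (hSO : ∀ ω ∈ S, (x₀, ω) ∈ O) (hF : ContinuousOn F O) :
    ∃ C : ℝ, ∃ U ∈ 𝓝 x₀, ∀ x ∈ U, ∀ ω ∈ S, (x, ω) ∈ O ∧ ‖F (x, ω)‖ ≤ C := by
  have hK : IsCompact ({x₀} ×ˢ S) := isCompact_singleton.prod hS
  have hKO : {x₀} ×ˢ S ⊆ O := by
    rintro ⟨x, ω⟩ ⟨rfl, hω⟩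
    exact hSO ω hω
  obtain ⟨C, hC⟩ := hK.exists_bound_of_continuousOn (hF.mono hKO)
  -- Relaxing the bound from C to C + 1 makes it an open condition, as the tube lemma requires.
  have hopen : IsOpen (O ∩ F ⁻¹' ball 0 (C + 1)) := hF.isOpen_inter_preimage hO isOpen_ball
  obtain ⟨u, v, hu, -, hxu, hSv, huv⟩ := generalized_tube_lemma (s := {x₀}) isCompact_singleton hS
    hopen (fun p hp => ⟨hKO hp, by
      rw [mem_preimage, mem_ball_zero_iff]; linarith [hC p hp]⟩)
  refine ⟨C + 1, u, hu.mem_nhds (hxu rfl), fun x hx ω hω => ?_⟩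
  have := huv (show (x, ω) ∈ u ×ˢ v from ⟨hx, hSv hω⟩)
  exact ⟨this.1, (by simpa using this.2 : ‖F (x, ω)‖ < C + 1).le⟩

omit [NormedSpace ℝ X] in
theorem aestronglyMeasurable_section {G : Type*} [NormedAddCommGroup G] [SecondCountableTopology E]
    {F : X × E → G} (hS : IsCompact S) (hF : ContinuousOn F O) {x : X}
    (hx : ∀ ω ∈ S, (x, ω) ∈ O) :
    AEStronglyMeasurable (fun ω => F (x, ω)) (μ.restrict S) :=
  (hF.comp (by fun_prop) hx : ContinuousOn (fun ω => F (x, ω)) S).aestronglyMeasurable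
    hS.measurableSet

omit [NormedSpace ℝ X] in
theorem continuousAt_setIntegral_of_continuousOn [SecondCountableTopology E] {F : X × E → ℝ}
    (hS : IsCompact S) (hμ : μ S < ⊤)
    (hO : IsOpen O) (hSO : ∀ ω ∈ S, (x₀, ω) ∈ O) (hF : ContinuousOn F O) :
    ContinuousAt (fun x => ∫ ω in S, F (x, ω) ∂μ) x₀ := by
  obtain ⟨C, U, hU, h⟩ := exists_tube_norm_le hS hO hSO hF
  have : IsFiniteMeasure (μ.restrict S) := ⟨by simpa using hμ⟩
  refine continuousAt_of_dominated (bound := fun _ => C) ?_ ?_ (integrable_const C) ?_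
  · filter_upwards [hU] with x hx using aestronglyMeasurable_section hS hF fun ω hω => (h x hx ω hω).1
  · filter_upwards [hU] with x hx
    filter_upwards [ae_restrict_mem hS.measurableSet] with ω hω using (h x hx ω hω).2
  · filter_upwards [ae_restrict_mem hS.measurableSet] with ω hω
    have : ContinuousAt F (x₀, ω) := hF.continuousAt (hO.mem_nhds (hSO ω hω))
    exact this.comp (f := fun x => (x, ω)) (by fun_prop)

/-- Differentiation under the integral sign over a compact set, for a jointly `C¹` integrand. -/
theorem exists_hasFDerivAt_setIntegral_of_contDiffOn {E : Type*} [NormedAddCommGroup E]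
    [NormedSpace ℝ E] [MeasurableSpace E] [BorelSpace E] [SecondCountableTopology E]
    {μ : Measure E} {S : Set E} {O : Set (X × E)} {F : X × E → ℝ}
    (hS : IsCompact S) (hμ : μ S < ⊤) (hO : IsOpen O) (hSO : ∀ ω ∈ S, (x₀, ω) ∈ O)
    (hF : ContDiffOn ℝ 1 F O) :
    ∃ L : X →L[ℝ] ℝ, HasFDerivAt (fun x => ∫ ω in S, F (x, ω) ∂μ) L x₀ ∧
      ∀ V, L V = ∫ ω in S, fderiv ℝ F (x₀, ω) (V, 0) ∂μ := by
  set F' : X × E → (X →L[ℝ] ℝ) := fun p => (fderiv ℝ F p).comp (ContinuousLinearMap.inl ℝ X E)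
  have hF' : ContinuousOn F' O :=
    (hF.continuousOn_fderiv_of_isOpen hO le_rfl).clm_comp continuousOn_const
  have : IsFiniteMeasure (μ.restrict S) := ⟨by simpa using hμ⟩
  obtain ⟨C, U, hU, h⟩ := exists_tube_norm_le hS hO hSO hF'
  obtain ⟨C₀, U₀, hU₀, h₀⟩ := exists_tube_norm_le hS hO hSO hF.continuousOn
  have hint : Integrable (fun ω => F' (x₀, ω)) (μ.restrict S) := by
    refine Integrable.of_bound (aestronglyMeasurable_section hS hF' hSO) C ?_
    filter_upwards [ae_restrict_mem hS.measurableSet] with ω hω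
      using (h x₀ (mem_of_mem_nhds hU) ω hω).2
  refine ⟨∫ ω in S, F' (x₀, ω) ∂μ, ?_, fun V => ?_⟩
  · refine hasFDerivAt_integral_of_dominated_of_fderiv_le (F := fun x ω => F (x, ω))
      (F' := fun x ω => F' (x, ω)) (bound := fun _ => C) hU ?_ ?_ ?_ ?_ (integrable_const C) ?_
    · filter_upwards [hU] with x hx
        using aestronglyMeasurable_section hS hF.continuousOn fun ω hω => (h x hx ω hω).1
    · refine Integrable.of_bound (aestronglyMeasurable_section hS hF.continuousOn hSO) C₀ ?_
      filter_upwards [ae_restrict_mem hS.measurableSet] with ω hω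
        using (h₀ x₀ (mem_of_mem_nhds hU₀) ω hω).2
    · exact aestronglyMeasurable_section hS hF' hSO
    · filter_upwards [ae_restrict_mem hS.measurableSet] with ω hω x hx using (h x hx ω hω).2
    · filter_upwards [ae_restrict_mem hS.measurableSet] with ω hω x hx
      have hd : HasFDerivAt F (fderiv ℝ F (x, ω)) (x, ω) :=
        ((hF.differentiableOn one_ne_zero).differentiableAt
          (hO.mem_nhds (h x hx ω hω).1)).hasFDerivAt
      exact hd.comp x (hasFDerivAt_prodMk_left x ω)
  · rw [ContinuousLinearMap.integral_apply hint]
    rfl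

end Parametric

/-! ### Reflections as functions of the normal vector. -/

section Householder

variable {V : Type*} [NormedAddCommGroup V] [InnerProductSpace ℝ V]

/-- The reflection of `ω` in the hyperplane orthogonal to `v`. -/
noncomputable def householder (v ω : V) : V := ω - (2 * inner ℝ v ω / ‖v‖ ^ 2) • v

/-- The derivative of `v ↦ householder v ω` in the direction `W`. -/
noncomputable def householderDeriv (v W ω : V) : V :=
  -((2 * inner ℝ v ω / ‖v‖ ^ 2) • W +
    ((2 * inner ℝ W ω * ‖v‖ ^ 2 - 2 * inner ℝ v ω * (2 * inner ℝ v W)) / (‖v‖ ^ 2) ^ 2) • v)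

theorem reflection_eq_householder (v ω : V) : (ℝ ∙ v)ᗮ.reflection ω = householder v ω := by
  rw [Submodule.reflection_orthogonal_apply, Submodule.reflection_singleton_apply, householder,
    neg_sub, ← Nat.cast_smul_eq_nsmul ℝ, smul_smul]
  simp [mul_div_assoc]

theorem norm_householder (v ω : V) : ‖householder v ω‖ = ‖ω‖ := by
  rw [← reflection_eq_householder, LinearIsometryEquiv.norm_map]

theorem householder_eq_self {v ω : V} (h : inner ℝ v ω = 0) : householder v ω = ω := by
  simp [householder, h]

theorem inner_householder_self {v : V} (hv : v ≠ 0) (ω : V) :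
    inner ℝ v (householder v ω) = -inner ℝ v ω := by
  have : ‖v‖ ≠ 0 := norm_ne_zero_iff.2 hv
  rw [householder, inner_sub_right, inner_smul_right, real_inner_self_eq_norm_sq]
  field_simp
  ring

theorem inner_householder (v W ω : V) :
    inner ℝ W (householder v ω) = inner ℝ W ω - 2 * inner ℝ v ω / ‖v‖ ^ 2 * inner ℝ W v := by
  rw [householder, inner_sub_right, inner_smul_right]

theorem contDiffOn_householder {n : WithTop ℕ∞} :
    ContDiffOn ℝ n (fun p : V × V => householder p.1 p.2) {p | p.1 ≠ 0} := by
  unfold householder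
  have h1 : ContDiffOn ℝ n (fun p : V × V => ‖p.1‖ ^ 2) {p | p.1 ≠ 0} :=
    ((contDiff_norm_sq ℝ).comp contDiff_fst).contDiffOn
  have h2 : ContDiffOn ℝ n (fun p : V × V => 2 * inner ℝ p.1 p.2) {p | p.1 ≠ 0} :=
    (contDiff_const.mul (contDiff_fst.inner ℝ contDiff_snd)).contDiffOn
  exact contDiff_snd.contDiffOn.sub
    ((h2.div h1 fun p hp => by simpa using hp).smul contDiff_fst.contDiffOn)

theorem hasDerivAt_householder {v : V} (hv : v ≠ 0) (W ω : V) :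
    HasDerivAt (fun t : ℝ => householder (v + t • W) ω) (householderDeriv v W ω) 0 := by
  have hc : HasDerivAt (fun t : ℝ => v + t • W) W 0 := by
    simpa using ((hasDerivAt_id (0 : ℝ)).smul_const W).const_add v
  have h1 : HasDerivAt (fun t : ℝ => 2 * inner ℝ (v + t • W) ω) (2 * inner ℝ W ω) 0 := by
    simpa using (hc.inner ℝ (hasDerivAt_const 0 ω)).const_mul 2
  have h2 : HasDerivAt (fun t : ℝ => ‖v + t • W‖ ^ 2) (2 * inner ℝ v W) 0 := by
    simpa using hc.norm_sq
  have h3 := h1.div h2 (by simpa using hv)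
  have h4 := (h3.fun_smul hc).const_sub ω
  simpa [householder, householderDeriv] using h4

omit [InnerProductSpace ℝ V] in
theorem isOpen_fst_ne_zero_snd_ne_zero : IsOpen {p : V × V | p.1 ≠ 0 ∧ p.2 ≠ 0} :=
  (isOpen_ne_fun continuous_fst continuous_const).inter
    (isOpen_ne_fun continuous_snd continuous_const)

theorem householder_ne_zero {v ω : V} (h : ω ≠ 0) : householder v ω ≠ 0 := by
  rw [← norm_ne_zero_iff, norm_householder]
  exact norm_ne_zero_iff.2 h

theorem contDiffOn_comp_householder {n : WithTop ℕ∞} {f : V → ℝ} (hf : ContDiffOn ℝ n f {0}ᶜ) :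
    ContDiffOn ℝ n (fun p : V × V => f (householder p.1 p.2)) {p | p.1 ≠ 0 ∧ p.2 ≠ 0} :=
  hf.comp (contDiffOn_householder.mono fun _ hp => hp.1) fun _ hp => householder_ne_zero hp.2

/-- Both sides are the derivative at t = 0 of f along the curve t ↦ `householder (v + t • W) ω`. -/
theorem fderiv_comp_householder {f : V → ℝ} (hf : ContDiffOn ℝ 1 f {0}ᶜ) {v ω : V} (hv : v ≠ 0)
    (hω : ω ≠ 0) (W : V) :
    fderiv ℝ (fun p : V × V => f (householder p.1 p.2)) (v, ω) (W, 0) =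
      fderiv ℝ f (householder v ω) (householderDeriv v W ω) := by
  have hΦ : HasFDerivAt (fun p : V × V => f (householder p.1 p.2)) _ (v, ω) :=
    (((contDiffOn_comp_householder hf).differentiableOn one_ne_zero).differentiableAt
      (isOpen_fst_ne_zero_snd_ne_zero.mem_nhds ⟨hv, hω⟩)).hasFDerivAt
  have hc : HasDerivAt (fun t : ℝ => (v + t • W, ω)) (W, 0) 0 := by
    have : HasDerivAt (fun t : ℝ => v + t • W) W 0 := by
      simpa using ((hasDerivAt_id (0 : ℝ)).smul_const W).const_add v
    exact this.prodMk (hasDerivAt_const 0 ω)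
  have h1 := HasFDerivAt.comp_hasDerivAt_of_eq (0 : ℝ) hΦ hc (by simp)
  have hf' : HasFDerivAt f (fderiv ℝ f (householder v ω)) (householder v ω) :=
    ((hf.differentiableOn one_ne_zero).differentiableAt
      (isOpen_compl_singleton.mem_nhds (householder_ne_zero hω))).hasFDerivAt
  have h2 := HasFDerivAt.comp_hasDerivAt_of_eq (0 : ℝ) hf' (hasDerivAt_householder hv W ω)
    (by simp)
  exact h1.unique h2

end Householder

/-! ### Integrals over great subspheres: dependence on Z and rotation invariance. -/

section Integral

variable {V : Type*} [NormedAddCommGroup V] [InnerProductSpace ℝ V] [FiniteDimensional ℝ V]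
  [MeasurableSpace V] [BorelSpace V] {n : ℕ}

omit [FiniteDimensional ℝ V] [MeasurableSpace V] [BorelSpace V] in
theorem subsphere_smul {c : ℝ} (hc : c ≠ 0) (Z : V) : subsphere (c • Z) = subsphere Z := by
  ext ω
  simp [mem_subsphere, inner_smul_left, hc]

omit [FiniteDimensional ℝ V] in
theorem setIntegral_subsphere_map (ρ : V ≃ₗᵢ[ℝ] V) (f : V → ℝ) (Z : V) :
    ∫ ω in subsphere (ρ Z), f ω ∂μHE[n] = ∫ ω in subsphere Z, f (ρ ω) ∂μHE[n] := by
  have hpre : ρ ⁻¹' subsphere (ρ Z) = subsphere Z := by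
    ext ω
    simp [mem_subsphere]
  have hmp : MeasurePreserving ρ (μHE[n] : Measure V) μHE[n] :=
    ρ.toIsometryEquiv.measurePreserving_euclideanHausdorffMeasure n
  rw [← hmp.setIntegral_preimage_emb ρ.toHomeomorph.measurableEmbedding, hpre]

omit [FiniteDimensional ℝ V] in
theorem setIntegral_subsphere_householder (v : V) (f : V → ℝ) (Z : V) :
    ∫ ω in subsphere (householder v Z), f ω ∂μHE[n] =
      ∫ ω in subsphere Z, f (householder v ω) ∂μHE[n] := by
  simpa only [reflection_eq_householder] using
    setIntegral_subsphere_map (n := n) (ℝ ∙ v)ᗮ.reflection f Z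

theorem integrableOn_subsphere (hn : Module.finrank ℝ V = n + 2) {Z : V} (hZ : Z ≠ 0) {f : V → ℝ}
    (hf : ContinuousOn f {0}ᶜ) : IntegrableOn f (subsphere Z) μHE[n] := by
  have hf' : ContinuousOn f (subsphere Z) := hf.mono fun _ h => ne_zero_of_mem_subsphere h
  obtain ⟨C, hC⟩ := (isCompact_subsphere Z).exists_bound_of_continuousOn hf'
  have hm := (isCompact_subsphere Z).measurableSet
  exact IntegrableOn.of_bound (euclideanHausdorffMeasure_subsphere_lt_top hn hZ)
    (hf'.aestronglyMeasurable hm) C (by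
      filter_upwards [ae_restrict_mem hm] with ω hω using hC ω hω)

-- The vectors |Z'|Z and |Z|Z' have equal norms, so reflecting along their sum exchanges them up to
-- sign. The sum is used, not the difference, because it stays nonzero as Z' → Z; the sign is
-- harmless since `subsphere` depends only on the line.
omit [FiniteDimensional ℝ V] [MeasurableSpace V] [BorelSpace V] in
theorem householder_add_smul {Z Z' : V} (hZ' : Z' ≠ 0) (hv : ‖Z'‖ • Z + ‖Z‖ • Z' ≠ 0) :
    householder (‖Z'‖ • Z + ‖Z‖ • Z') Z = -(‖Z‖ / ‖Z'‖) • Z' := by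
  set v := ‖Z'‖ • Z + ‖Z‖ • Z' with hvdef
  have ha : ‖Z'‖ ≠ 0 := norm_ne_zero_iff.2 hZ'
  have hsq : ‖v‖ ^ 2 = 2 * inner ℝ v Z * ‖Z'‖ := by
    rw [← real_inner_self_eq_norm_sq, hvdef]
    simp only [inner_add_left, inner_add_right, inner_smul_left, inner_smul_right,
      real_inner_self_eq_norm_sq, real_inner_comm Z Z', conj_trivial]
    ring
  have hvn : ‖v‖ ≠ 0 := norm_ne_zero_iff.2 hv
  have hc : 2 * inner ℝ v Z / ‖v‖ ^ 2 = ‖Z'‖⁻¹ := by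
    rw [div_eq_iff (by positivity), hsq]
    field_simp
  rw [householder, hc, hvdef, smul_add, smul_smul, smul_smul, inv_mul_cancel₀ ha, one_smul,
    div_eq_inv_mul]
  module

omit [FiniteDimensional ℝ V] in
/-- Near `Z`, the integral over a varying great subsphere is an integral over a fixed one. -/
theorem eventually_setIntegral_subsphere_eq {Z : V} (hZ : Z ≠ 0) (f : V → ℝ) :
    ∀ᶠ Z' in 𝓝 Z, ∫ ω in subsphere Z', f ω ∂μHE[n] =
      ∫ ω in subsphere Z, f (householder (‖Z'‖ • Z + ‖Z‖ • Z') ω) ∂μHE[n] := by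
  have hcont : ContinuousAt (fun Z' : V => ‖Z'‖ • Z + ‖Z‖ • Z') Z := by fun_prop
  have hv : ‖Z‖ • Z + ‖Z‖ • Z ≠ 0 := by
    rw [← two_smul ℝ, smul_smul]
    simpa using hZ
  filter_upwards [hcont.eventually_ne hv, eventually_ne_nhds hZ] with Z' h1 h2
  rw [← setIntegral_subsphere_householder, householder_add_smul h2 h1, subsphere_smul]
  simpa using ⟨hZ, h2⟩

theorem continuousAt_setIntegral_subsphere (hn : Module.finrank ℝ V = n + 2) {Z : V} (hZ : Z ≠ 0)
    {f : V → ℝ} (hf : ContinuousOn f {0}ᶜ) :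
    ContinuousAt (fun Z => ∫ ω in subsphere Z, f ω ∂μHE[n]) Z := by
  have hv : ‖Z‖ • Z + ‖Z‖ • Z ≠ 0 := by
    rw [← two_smul ℝ, smul_smul]
    simpa using hZ
  refine ContinuousAt.congr ?_ ((eventually_setIntegral_subsphere_eq hZ f).mono fun _ h => h.symm)
  have hf' := (contDiffOn_comp_householder (contDiffOn_zero.2 hf)).continuousOn
  refine ContinuousAt.comp (f := fun Z' : V => ‖Z'‖ • Z + ‖Z‖ • Z')
    (g := fun v => ∫ ω in subsphere Z, f (householder v ω) ∂μHE[n]) ?_ (by fun_prop)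
  exact continuousAt_setIntegral_of_continuousOn
    (F := fun p : V × V => f (householder p.1 p.2)) (isCompact_subsphere Z)
    (euclideanHausdorffMeasure_subsphere_lt_top hn hZ) isOpen_fst_ne_zero_snd_ne_zero
    (fun ω hω => ⟨hv, ne_zero_of_mem_subsphere hω⟩) hf'

theorem exists_hasFDerivAt_setIntegral_householder (hn : Module.finrank ℝ V = n + 2) {Z : V}
    (hZ : Z ≠ 0) {f : V → ℝ} (hf : ContDiffOn ℝ 1 f {0}ᶜ) {v : V} (hv : v ≠ 0) :
    ∃ L : V →L[ℝ] ℝ,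
      HasFDerivAt (fun v => ∫ ω in subsphere Z, f (householder v ω) ∂μHE[n]) L v ∧
      ∀ W, L W = ∫ ω in subsphere Z,
        fderiv ℝ f (householder v ω) (householderDeriv v W ω) ∂μHE[n] := by
  obtain ⟨L, hL, hLW⟩ := exists_hasFDerivAt_setIntegral_of_contDiffOn (x₀ := v)
    (F := fun p : V × V => f (householder p.1 p.2)) (isCompact_subsphere Z)
    (euclideanHausdorffMeasure_subsphere_lt_top hn hZ) isOpen_fst_ne_zero_snd_ne_zero
    (fun ω hω => ⟨hv, ne_zero_of_mem_subsphere hω⟩) (contDiffOn_comp_householder hf)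
  refine ⟨L, hL, fun W => ?_⟩
  rw [hLW]
  exact setIntegral_congr_fun (isCompact_subsphere Z).measurableSet fun ω hω =>
    fderiv_comp_householder hf hv (ne_zero_of_mem_subsphere hω) W

/-- The derivative of the integral over the great subsphere `S ∩ Z^⊥` with respect to `Z`. -/
theorem exists_hasFDerivAt_setIntegral_subsphere (hn : Module.finrank ℝ V = n + 2) {Z : V}
    (hZ : Z ≠ 0) {f : V → ℝ} (hf : ContDiffOn ℝ 1 f {0}ᶜ) :
    ∃ L : V →L[ℝ] ℝ, HasFDerivAt (fun Z => ∫ ω in subsphere Z, f ω ∂μHE[n]) L Z ∧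
      ∀ W, L W = -(‖Z‖ ^ 2)⁻¹ * ∫ ω in subsphere Z, inner ℝ W ω * fderiv ℝ f ω Z ∂μHE[n] := by
  have hb : ‖Z‖ ≠ 0 := norm_ne_zero_iff.2 hZ
  have hv2 : ‖Z‖ • Z + ‖Z‖ • Z = (2 * ‖Z‖) • Z := by module
  have hv : ‖Z‖ • Z + ‖Z‖ • Z ≠ 0 := by simpa [hv2] using hZ
  obtain ⟨L, hL, hLW⟩ := exists_hasFDerivAt_setIntegral_householder (n := n) hn hZ hf hv
  have hd : HasFDerivAt (fun Z' : V => ‖Z'‖ • Z + ‖Z‖ • Z')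
      ((fderiv ℝ (fun Z' : V => ‖Z'‖) Z).smulRight Z + ‖Z‖ • ContinuousLinearMap.id ℝ V) Z :=
    ((differentiableAt_id.norm ℝ hZ).hasFDerivAt.smul_const Z).add
      ((hasFDerivAt_id Z).const_smul ‖Z‖)
  have hcomp := HasFDerivAt.comp Z hL hd
  refine ⟨_, hcomp.congr_of_eventuallyEq (eventually_setIntegral_subsphere_eq hZ f),
    fun W => ?_⟩
  rw [ContinuousLinearMap.comp_apply, hLW, ← integral_const_mul]
  refine setIntegral_congr_fun (isCompact_subsphere Z).measurableSet fun ω hω => ?_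
  have h0 : inner ℝ Z ω = 0 := (mem_subsphere.1 hω).2
  have hH : householder (‖Z‖ • Z + ‖Z‖ • Z) ω = ω :=
    householder_eq_self (by rw [hv2, inner_smul_left, h0, mul_zero])
  -- The coefficient α, which comes from the derivative of the norm, drops out: a reflection depends
  -- only on the line of its normal vector.
  have hD : ∀ α : ℝ, householderDeriv (‖Z‖ • Z + ‖Z‖ • Z) (α • Z + ‖Z‖ • W) ω =
      (-(‖Z‖ ^ 2)⁻¹ * inner ℝ W ω) • Z := by
    intro α
    have hnorm : ‖(2 * ‖Z‖) • Z‖ = 2 * ‖Z‖ ^ 2 := by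
      rw [norm_smul, Real.norm_of_nonneg (by positivity)]
      ring
    rw [hv2, householderDeriv, hnorm]
    simp only [inner_smul_left, inner_add_left, h0, conj_trivial, mul_zero, zero_div, zero_smul,
      zero_mul, zero_add, sub_zero, smul_smul, ← neg_smul]
    congr 1
    field_simp
  simp only [hH]
  have := hD (fderiv ℝ (fun Z' : V => ‖Z'‖) Z W)
  simp only [_root_.add_apply, ContinuousLinearMap.smulRight_apply,
    _root_.smul_apply, ContinuousLinearMap.id_apply]
  rw [this, map_smul, smul_eq_mul, mul_assoc]

/-- Invariance of the integral over a subsphere under the infinitesimal rotations of its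
hyperplane. -/
theorem setIntegral_subsphere_fderiv_rotation (hn : Module.finrank ℝ V = n + 2) {Z : V}
    (hZ : Z ≠ 0) {f : V → ℝ} (hf : ContDiffOn ℝ 1 f {0}ᶜ) {e W : V} (he : inner ℝ e Z = 0)
    (hW : inner ℝ W Z = 0) :
    ∫ ω in subsphere Z, fderiv ℝ f ω (inner ℝ e ω • W - inner ℝ W ω • e) ∂μHE[n] = 0 := by
  rcases eq_or_ne e 0 with rfl | he0
  · simp
  have hne : ‖e‖ ≠ 0 := norm_ne_zero_iff.2 he0
  obtain ⟨L, hL, hLW⟩ := exists_hasFDerivAt_setIntegral_householder (n := n) hn hZ hf he0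
  -- Every e + tW is orthogonal to Z, so these reflections fix Z and preserve its subsphere.
  have hconst : ∀ t : ℝ, ∫ ω in subsphere Z, f (householder (e + t • W) ω) ∂μHE[n] =
      ∫ ω in subsphere Z, f ω ∂μHE[n] := by
    intro t
    rw [← setIntegral_subsphere_householder, householder_eq_self]
    rw [inner_add_left, inner_smul_left, he, hW]
    simp
  have hc : HasDerivAt (fun t : ℝ => e + t • W) W 0 := by
    simpa using ((hasDerivAt_id (0 : ℝ)).smul_const W).const_add e
  have h1 := HasFDerivAt.comp_hasDerivAt_of_eq (0 : ℝ) hL hc (by simp)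
  have h2 : L W = 0 := by
    refine h1.unique ?_
    have : ((fun v => ∫ ω in subsphere Z, f (householder v ω) ∂μHE[n]) ∘ fun t : ℝ => e + t • W) =
        fun _ => ∫ ω in subsphere Z, f ω ∂μHE[n] := funext hconst
    rw [this]
    exact hasDerivAt_const _ _
  have h3 := setIntegral_subsphere_householder (n := n) e
    (fun ω => fderiv ℝ f ω (inner ℝ e ω • W - inner ℝ W ω • e)) Z
  rw [householder_eq_self he] at h3
  -- The velocity is an infinitesimal rotation evaluated at the reflected point; the invariance `h3`
  -- then removes the reflection.
  have h4 : ∀ ω, householderDeriv e W ω = (2 * (‖e‖ ^ 2)⁻¹) •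
      (inner ℝ e (householder e ω) • W - inner ℝ W (householder e ω) • e) := by
    intro ω
    rw [inner_householder_self he0, inner_householder, householderDeriv, real_inner_comm W e]
    match_scalars <;> field_simp
  rw [hLW] at h2
  simp only [h4, map_smul, smul_eq_mul] at h2
  rw [integral_const_mul, ← h3] at h2
  exact (mul_eq_zero.1 h2).resolve_left (by positivity)

end Integral

/-! ### Homogeneous functions, Euler's identity and coordinate derivatives. -/

section Homogeneous

variable {N : ℕ} {f g : EuclideanSpace ℝ (Fin N) → ℝ} {d : ℤ}

/-- `f` is positively homogeneous of degree `d` away from the origin. -/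
def IsPosHomogeneous (d : ℤ) (f : EuclideanSpace ℝ (Fin N) → ℝ) : Prop :=
  ∀ t : ℝ, 0 < t → ∀ y : EuclideanSpace ℝ (Fin N), y ≠ 0 → f (t • y) = t ^ d * f y

theorem contDiffAt_of_contDiffOn_compl {n : WithTop ℕ∞} (hf : ContDiffOn ℝ n f {0}ᶜ)
    {y : EuclideanSpace ℝ (Fin N)} (hy : y ≠ 0) : ContDiffAt ℝ n f y :=
  hf.contDiffAt (isOpen_compl_singleton.mem_nhds hy)

/-- Euler's identity: differentiate the homogeneity relation in t at t = 1. -/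
theorem IsPosHomogeneous.fderiv_apply_self (hf : IsPosHomogeneous d f)
    {y : EuclideanSpace ℝ (Fin N)} (hy : y ≠ 0) (hd : DifferentiableAt ℝ f y) :
    fderiv ℝ f y y = d * f y := by
  have hc : HasDerivAt (fun t : ℝ => t • y) y 1 := by
    simpa using (hasDerivAt_id (1 : ℝ)).smul_const y
  have h1 := HasFDerivAt.comp_hasDerivAt_of_eq (1 : ℝ) hd.hasFDerivAt hc (by simp)
  have h2 : HasDerivAt (fun t : ℝ => t ^ d * f y) (d * f y) 1 := by
    simpa using (hasDerivAt_zpow d (1 : ℝ) (Or.inl one_ne_zero)).mul_const (f y)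
  refine h1.unique (h2.congr_of_eventuallyEq ?_)
  filter_upwards [lt_mem_nhds (zero_lt_one' ℝ)] with t ht using hf t ht y hy

theorem IsPosHomogeneous.partialDeriv (hf : IsPosHomogeneous (d + 1) f)
    (hd : ∀ y ≠ 0, DifferentiableAt ℝ f y) (i : Fin N) :
    IsPosHomogeneous d (partialDeriv i f) := by
  intro t ht y hy
  have h1 : HasFDerivAt (fun y => f (t • y)) (t • fderiv ℝ f (t • y)) y := by
    have := (hd (t • y) (by simp [ht.ne', hy])).hasFDerivAt.comp y
      ((hasFDerivAt_id y).const_smul t)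
    exact HasFDerivAt.congr_fderiv this (by ext; simp)
  have h2 : HasFDerivAt (fun y => f (t • y)) (t ^ (d + 1) • fderiv ℝ f y) y := by
    refine ((hd y hy).hasFDerivAt.const_mul (t ^ (d + 1))).congr_of_eventuallyEq ?_
    filter_upwards [eventually_ne_nhds hy] with z hz using hf t ht z hz
  have h3 := congrArg (fun L => L (EuclideanSpace.single i (1 : ℝ))) (h1.unique h2)
  simp only [_root_.smul_apply, smul_eq_mul, zpow_add_one₀ ht.ne'] at h3
  refine mul_left_cancel₀ ht.ne' ?_
  unfold _root_.partialDeriv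
  linear_combination h3

theorem IsPosHomogeneous.coord_mul (hf : IsPosHomogeneous d f) (i : Fin N) :
    IsPosHomogeneous (d + 1) (fun y => y i * f y) := by
  intro t ht y hy
  simp only [hf t ht y hy, PiLp.smul_apply, smul_eq_mul, zpow_add_one₀ ht.ne']
  ring

theorem contDiffOn_coord_mul {n : WithTop ℕ∞} (hf : ContDiffOn ℝ n f {0}ᶜ) (i : Fin N) :
    ContDiffOn ℝ n (fun y => y i * f y) {0}ᶜ :=
  (EuclideanSpace.proj (𝕜 := ℝ) i).contDiff.contDiffOn.mul hf

theorem contDiffOn_fderiv_apply {n : WithTop ℕ∞} (hf : ContDiffOn ℝ (n + 1) f {0}ᶜ)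
    (W : EuclideanSpace ℝ (Fin N)) : ContDiffOn ℝ n (fun y => fderiv ℝ f y W) {0}ᶜ :=
  ((contDiffOn_succ_iff_fderiv_of_isOpen isOpen_compl_singleton).1 hf).2.2.clm_apply
    contDiffOn_const

theorem contDiffOn_partialDeriv {n : WithTop ℕ∞} (hf : ContDiffOn ℝ (n + 1) f {0}ᶜ) (i : Fin N) :
    ContDiffOn ℝ n (partialDeriv i f) {0}ᶜ :=
  contDiffOn_fderiv_apply hf _

theorem partialDeriv_eqOn (h : EqOn f g {0}ᶜ) (i : Fin N) :
    EqOn (partialDeriv i f) (partialDeriv i g) {0}ᶜ := by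
  intro y hy
  have : f =ᶠ[𝓝 y] g := by
    filter_upwards [isOpen_compl_singleton.mem_nhds hy] with z hz using h hz
  simp only [partialDeriv, this.fderiv_eq]

theorem fderiv_coord_mul {y : EuclideanSpace ℝ (Fin N)} (hf : DifferentiableAt ℝ f y) (i : Fin N)
    (W : EuclideanSpace ℝ (Fin N)) :
    fderiv ℝ (fun y => y i * f y) y W = W i * f y + y i * fderiv ℝ f y W := by
  have h1 : HasFDerivAt (fun y : EuclideanSpace ℝ (Fin N) => y i)
      (EuclideanSpace.proj (𝕜 := ℝ) i) y := (EuclideanSpace.proj (𝕜 := ℝ) i).hasFDerivAt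
  have h2 : HasFDerivAt (fun y => y i * f y) _ y := h1.mul hf.hasFDerivAt
  rw [h2.fderiv]
  simp
  ring

end Homogeneous

/-! ### First-order formula and smoothness of the Radon transform. -/

section Radon

variable {m : ℕ} {f g : EuclideanSpace ℝ (Fin (m + 1)) → ℝ} {Z : EuclideanSpace ℝ (Fin (m + 1))}

theorem extendedRadon_eq (g : EuclideanSpace ℝ (Fin (m + 1)) → ℝ) (hZ : Z ≠ 0) :
    extendedRadon m g Z =
      (μHE[m - 1].real (sphere (0 : EuclideanSpace ℝ (Fin m)) 1))⁻¹ *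
        (‖Z‖⁻¹ * ∫ ω in subsphere Z, g ω ∂μHE[m - 1]) := by
  rw [extendedRadon, sphericalRadon, ← subsphere, subsphere_smul (by simpa using hZ)]
  ring

theorem extendedRadon_congr (h : EqOn f g {0}ᶜ) (hZ : Z ≠ 0) :
    extendedRadon m f Z = extendedRadon m g Z := by
  rw [extendedRadon_eq f hZ, extendedRadon_eq g hZ,
    setIntegral_congr_fun (isCompact_subsphere Z).measurableSet
      (h.mono fun _ hω => ne_zero_of_mem_subsphere hω)]

theorem finrank_euclideanSpace_eq (hm : 1 ≤ m) :
    Module.finrank ℝ (EuclideanSpace ℝ (Fin (m + 1))) = m - 1 + 2 := by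
  rw [finrank_euclideanSpace_fin]
  omega

theorem extendedRadon_add (hm : 1 ≤ m) (hf : ContinuousOn f {0}ᶜ) (hg : ContinuousOn g {0}ᶜ)
    (hZ : Z ≠ 0) :
    extendedRadon m (fun y => f y + g y) Z = extendedRadon m f Z + extendedRadon m g Z := by
  have hn := finrank_euclideanSpace_eq hm
  rw [extendedRadon_eq _ hZ, extendedRadon_eq _ hZ, extendedRadon_eq _ hZ,
    integral_add (integrableOn_subsphere hn hZ hf) (integrableOn_subsphere hn hZ hg)]
  ring

theorem extendedRadon_const_mul (c : ℝ) (f : EuclideanSpace ℝ (Fin (m + 1)) → ℝ) (hZ : Z ≠ 0) :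
    extendedRadon m (fun y => c * f y) Z = c * extendedRadon m f Z := by
  rw [extendedRadon_eq _ hZ, extendedRadon_eq _ hZ, integral_const_mul]
  ring

theorem continuousOn_extendedRadon (hm : 1 ≤ m) (hg : ContinuousOn g {0}ᶜ) :
    ContinuousOn (extendedRadon m g) {0}ᶜ := by
  refine ContinuousOn.congr (fun Z hZ => ContinuousAt.continuousWithinAt ?_)
    (fun Z hZ => extendedRadon_eq g hZ)
  have h1 := continuousAt_setIntegral_subsphere (finrank_euclideanSpace_eq hm) hZ hg
  exact continuousAt_const.mul ((continuous_norm.continuousAt.inv₀ (norm_ne_zero_iff.2 hZ)).mul h1)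

theorem fderiv_norm_apply {Z : EuclideanSpace ℝ (Fin (m + 1))} (hZ : Z ≠ 0)
    (W : EuclideanSpace ℝ (Fin (m + 1))) :
    fderiv ℝ (fun Z : EuclideanSpace ℝ (Fin (m + 1)) => ‖Z‖) Z W = inner ℝ Z W / ‖Z‖ := by
  have h1 := (differentiableAt_id.norm ℝ hZ).hasFDerivAt.pow 2
  have h2 := congrArg (fun L => L W) (h1.unique (hasStrictFDerivAt_norm_sq Z).hasFDerivAt)
  have hn : ‖Z‖ ≠ 0 := norm_ne_zero_iff.2 hZ
  simp at h2
  rw [eq_div_iff hn]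
  linarith

/-- The derivative of the Radon transform in terms of the derivative of `g` in the direction `Z`
normal to the hyperplane. -/
theorem exists_hasFDerivAt_extendedRadon (hm : 1 ≤ m) (hg : ContDiffOn ℝ 1 g {0}ᶜ) (hZ : Z ≠ 0) :
    ∃ L : EuclideanSpace ℝ (Fin (m + 1)) →L[ℝ] ℝ, HasFDerivAt (extendedRadon m g) L Z ∧
      ∀ i, ‖Z‖ ^ 2 * L (EuclideanSpace.single i 1) =
        -extendedRadon m (fun y => fderiv ℝ (fun y => y i * g y) y Z) Z := by
  have hn := finrank_euclideanSpace_eq hm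
  have hne : ‖Z‖ ≠ 0 := norm_ne_zero_iff.2 hZ
  obtain ⟨L, hL, hLW⟩ := exists_hasFDerivAt_setIntegral_subsphere hn hZ hg
  have hnorm : HasFDerivAt (fun Z : EuclideanSpace ℝ (Fin (m + 1)) => ‖Z‖⁻¹) _ Z :=
    (hasDerivAt_inv hne).comp_hasFDerivAt Z (differentiableAt_id.norm ℝ hZ).hasFDerivAt
  have hR := HasFDerivAt.congr_of_eventuallyEq ((hnorm.mul hL).const_mul
    (μHE[m - 1].real (sphere (0 : EuclideanSpace ℝ (Fin m)) 1))⁻¹)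
    (f₁ := extendedRadon m g) (by
      filter_upwards [eventually_ne_nhds hZ] with Z' hZ' using extendedRadon_eq g hZ')
  refine ⟨_, hR, fun i => ?_⟩
  -- The first summand matches the derivative of the factor |Z|⁻¹, the second that of the integral.
  have hint : ∫ ω in subsphere Z, fderiv ℝ (fun y => y i * g y) ω Z ∂μHE[m - 1] =
      Z i * ∫ ω in subsphere Z, g ω ∂μHE[m - 1] +
        ∫ ω in subsphere Z, ω i * fderiv ℝ g ω Z ∂μHE[m - 1] := by
    rw [← integral_const_mul, ← integral_add]
    · refine setIntegral_congr_fun (isCompact_subsphere Z).measurableSet fun ω hω => ?_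
      exact fderiv_coord_mul ((contDiffAt_of_contDiffOn_compl hg
        (ne_zero_of_mem_subsphere hω)).differentiableAt one_ne_zero) i Z
    · exact (integrableOn_subsphere hn hZ hg.continuousOn).const_mul _
    · exact integrableOn_subsphere hn hZ (contDiffOn_coord_mul (n := 0)
        (contDiffOn_fderiv_apply (by simpa using hg) Z) i).continuousOn
  have hLi := hLW (EuclideanSpace.single i 1)
  have hNi := fderiv_norm_apply hZ (EuclideanSpace.single i 1)
  simp only [EuclideanSpace.inner_single_left, EuclideanSpace.inner_single_right, map_one, one_mul,
    conj_trivial] at hLi hNi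
  rw [extendedRadon_eq _ hZ, hint]
  simp only [_root_.smul_apply, _root_.add_apply, smul_eq_mul, hLi, id, hNi]
  field_simp
  ring

/-- Integration by parts on the sphere of the hyperplane `Z^⊥` for homogeneous functions of the
critical degree. -/
theorem setIntegral_subsphere_fderiv_eq_zero (hm : 1 ≤ m) {h : EuclideanSpace ℝ (Fin (m + 1)) → ℝ}
    (hh : ContDiffOn ℝ 1 h {0}ᶜ) (hhom : IsPosHomogeneous (-m + 1) h) (hZ : Z ≠ 0)
    {W : EuclideanSpace ℝ (Fin (m + 1))} (hW : inner ℝ W Z = 0) :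
    ∫ ω in subsphere Z, fderiv ℝ h ω W ∂μHE[m - 1] = 0 := by
  have hn := finrank_euclideanSpace_eq hm
  have hne : ‖Z‖ ≠ 0 := norm_ne_zero_iff.2 hZ
  -- The projections of the standard basis to Z^⊥. The rotation identities for y_i h in the planes
  -- of e_i and W, summed over i, have integrand ∂_W h on the subsphere.
  let e : Fin (m + 1) → EuclideanSpace ℝ (Fin (m + 1)) := fun i =>
    EuclideanSpace.single i 1 - (Z i / ‖Z‖ ^ 2) • Z
  have he : ∀ i, inner ℝ (e i) Z = 0 := by
    intro i
    simp only [e, inner_sub_left, inner_smul_left, EuclideanSpace.inner_single_left, map_one,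
      one_mul, real_inner_self_eq_norm_sq, conj_trivial]
    field_simp
    ring
  have hrot := fun i => setIntegral_subsphere_fderiv_rotation hn hZ
    (contDiffOn_coord_mul hh i) (he i) hW
  rw [← Finset.sum_eq_zero (s := Finset.univ) (fun i _ => hrot i), ← integral_finsetSum]
  · refine setIntegral_congr_fun (isCompact_subsphere Z).measurableSet fun ω hω => ?_
    have hω0 := ne_zero_of_mem_subsphere hω
    obtain ⟨hω1, hωZ⟩ := mem_subsphere.1 hω
    have hdiff : DifferentiableAt ℝ h ω :=
      (contDiffAt_of_contDiffOn_compl hh hω0).differentiableAt one_ne_zero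
    have heul := hhom.fderiv_apply_self hω0 hdiff
    have hei : ∀ i, inner ℝ (e i) ω = ω i := by
      intro i
      simp [e, inner_sub_left, inner_smul_left, EuclideanSpace.inner_single_left, hωZ]
    have hterm : ∀ i, fderiv ℝ (fun y => y i * h y) ω (inner ℝ (e i) ω • W - inner ℝ W ω • e i) =
        h ω * (ω i * W i) - inner ℝ W ω * h ω + inner ℝ W ω * h ω / ‖Z‖ ^ 2 * Z i ^ 2 +
          fderiv ℝ h ω W * ω i ^ 2 -
          inner ℝ W ω * (ω i * fderiv ℝ h ω (EuclideanSpace.single i 1)) +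
          inner ℝ W ω * fderiv ℝ h ω Z / ‖Z‖ ^ 2 * (ω i * Z i) := by
      intro i
      rw [fderiv_coord_mul hdiff, hei]
      simp only [e, map_sub, map_smul, smul_eq_mul, PiLp.sub_apply, PiLp.smul_apply,
        PiLp.single_apply, if_true]
      field_simp
      ring
    have hωω : ∑ i, ω i ^ 2 = 1 := by
      rw [← EuclideanSpace.real_norm_sq_eq, hω1, one_pow]
    have hZω : ∑ i, ω i * Z i = 0 := by
      rw [← hωZ, PiLp.inner_apply]
      simp
    have hWω : ∑ i, ω i * W i = inner ℝ W ω := by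
      rw [PiLp.inner_apply]
      simp
    have hDω : ∑ i, ω i * fderiv ℝ h ω (EuclideanSpace.single i 1) = fderiv ℝ h ω ω := by
      simpa [map_sum] using congrArg (fderiv ℝ h ω)
        ((EuclideanSpace.basisFun (Fin (m + 1)) ℝ).sum_repr ω)
    -- Besides ∂_W h there remains ⟪W, ω⟫ h(ω) times 1 - (m + 1) + 1 - (-m + 1) = 0; the last
    -- bracket is Euler's degree, and this is where the critical degree enters.
    simp only [hterm, Finset.sum_add_distrib, Finset.sum_sub_distrib, ← Finset.mul_sum, hωω, hZω,
      hWω, hDω, ← EuclideanSpace.real_norm_sq_eq, heul, Finset.sum_const, Finset.card_univ,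
      Fintype.card_fin, nsmul_eq_mul]
    push_cast
    field_simp
    ring
  · intro i _
    have hc := ((contDiffOn_succ_iff_fderiv_of_isOpen (n := 0) isOpen_compl_singleton).1
      (by simpa using contDiffOn_coord_mul hh i)).2.2.continuousOn
    exact integrableOn_subsphere hn hZ (hc.clm_apply (by fun_prop))

/-- The first-order case of the differentiation formula. -/
theorem coord_mul_partialDeriv_extendedRadon (hm : 1 ≤ m) (hg : ContDiffOn ℝ 1 g {0}ᶜ)
    (hhom : IsPosHomogeneous (-m) g) (hZ : Z ≠ 0) (t s : Fin (m + 1)) :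
    Z t * partialDeriv s (extendedRadon m g) Z =
      -extendedRadon m (partialDeriv t (fun y => y s * g y)) Z := by
  have hn := finrank_euclideanSpace_eq hm
  have hne : ‖Z‖ ≠ 0 := norm_ne_zero_iff.2 hZ
  obtain ⟨L, hL, hLi⟩ := exists_hasFDerivAt_extendedRadon hm hg hZ
  have hh := contDiffOn_coord_mul hg s
  have hc : ∀ W, ContinuousOn (fun y => fderiv ℝ (fun y => y s * g y) y W) {0}ᶜ := fun W =>
    (contDiffOn_fderiv_apply (n := 0) (by simpa using hh) W).continuousOn
  set W : EuclideanSpace ℝ (Fin (m + 1)) := EuclideanSpace.single t 1 - (Z t / ‖Z‖ ^ 2) • Z with hWdef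
  have hW : inner ℝ W Z = 0 := by
    simp only [hWdef, inner_sub_left, inner_smul_left, EuclideanSpace.inner_single_left, map_one,
      one_mul, real_inner_self_eq_norm_sq, conj_trivial]
    field_simp
    ring
  have h0 := setIntegral_subsphere_fderiv_eq_zero hm hh (hhom.coord_mul s) hZ hW
  have hsplit : partialDeriv t (fun y => y s * g y) = fun y =>
      Z t / ‖Z‖ ^ 2 * fderiv ℝ (fun y => y s * g y) y Z + fderiv ℝ (fun y => y s * g y) y W := by
    funext y
    simp [partialDeriv, hWdef]
  have hcZ : ContinuousOn (fun y => Z t / ‖Z‖ ^ 2 * fderiv ℝ (fun y => y s * g y) y Z) {0}ᶜ :=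
    continuousOn_const.mul (hc Z)
  rw [hsplit, extendedRadon_add hm hcZ (hc W) hZ,
    extendedRadon_const_mul _ _ hZ, extendedRadon_eq (fun y => fderiv ℝ _ y W) hZ, h0, mul_zero,
    mul_zero, add_zero, ← mul_neg, ← hLi s, partialDeriv, hL.fderiv]
  field_simp

/-- Multiplying the first-order formula by Z_t and summing over t gives ∂_s R[g] = -|Z|⁻² Σ_t Z_t
R[∂_t(y_s g)], whose right side is C^k by induction when g is C^(k+1). -/
theorem contDiffOn_extendedRadon (hm : 1 ≤ m) (k : ℕ) (hg : ContDiffOn ℝ k g {0}ᶜ)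
    (hhom : IsPosHomogeneous (-m) g) : ContDiffOn ℝ k (extendedRadon m g) {0}ᶜ := by
  induction k generalizing g with
  | zero =>
    rw [Nat.cast_zero, contDiffOn_zero] at hg ⊢
    exact continuousOn_extendedRadon hm hg
  | succ k ih =>
    push_cast at hg ⊢
    have hg1 : ContDiffOn ℝ 1 g {0}ᶜ := hg.of_le (by simp)
    rw [contDiffOn_succ_iff_fderiv_of_isOpen isOpen_compl_singleton]
    refine ⟨fun Z hZ => ?_, by simp, ?_⟩
    · obtain ⟨L, hL, -⟩ := exists_hasFDerivAt_extendedRadon hm hg1 hZ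
      exact hL.differentiableAt.differentiableWithinAt
    rw [contDiffOn_clm_apply]
    intro W
    have hR : ∀ t s, ContDiffOn ℝ k
        (extendedRadon m (partialDeriv t (fun y => y s * g y))) {0}ᶜ := by
      intro t s
      refine ih (contDiffOn_partialDeriv (contDiffOn_coord_mul hg s) t) ?_
      refine (hhom.coord_mul s).partialDeriv (fun y hy => ?_) t
      exact (contDiffAt_of_contDiffOn_compl (contDiffOn_coord_mul hg1 s) hy).differentiableAt
        one_ne_zero
    have hN : ContDiffOn ℝ k (fun Z : EuclideanSpace ℝ (Fin (m + 1)) => ‖Z‖ ^ 2) {0}ᶜ :=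
      (contDiff_norm_sq ℝ).contDiffOn
    have hsum : ContDiffOn ℝ k (fun Z : EuclideanSpace ℝ (Fin (m + 1)) =>
        ∑ s, W s * ((-∑ t, Z t * extendedRadon m (partialDeriv t (fun y => y s * g y)) Z) /
          ‖Z‖ ^ 2)) {0}ᶜ := by
      refine ContDiffOn.sum fun s _ => contDiffOn_const.mul (ContDiffOn.div ?_ hN ?_)
      · exact (ContDiffOn.sum fun t _ => contDiffOn_coord_mul (hR t s) t).neg
      · intro Z hZ
        simpa using hZ
    refine hsum.congr fun Z hZ => ?_
    have hbasis : W = ∑ s, W s • EuclideanSpace.single s (1 : ℝ) := by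
      ext i
      simp [Finset.sum_apply, Pi.single_apply]
    conv_lhs => rw [hbasis, map_sum]
    refine Finset.sum_congr rfl fun s _ => ?_
    rw [map_smul, smul_eq_mul]
    congr 1
    have hne : ‖Z‖ ≠ 0 := norm_ne_zero_iff.2 hZ
    rw [eq_div_iff (by positivity), EuclideanSpace.real_norm_sq_eq, Finset.mul_sum,
      ← Finset.sum_neg_distrib]
    refine Finset.sum_congr rfl fun t _ => ?_
    have := coord_mul_partialDeriv_extendedRadon hm hg1 hhom hZ t s
    rw [partialDeriv] at this
    linear_combination Z t * this

end Radon

/-! ### Iterated derivatives, monomials and their commutators. -/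

section Iterated

variable {N : ℕ} {f g : EuclideanSpace ℝ (Fin N) → ℝ} {d : ℤ}

/-- The monomial `y ↦ y_{i₁} ⋯ y_{iₖ}` of a list of indices. -/
def coordMonomial (l : List (Fin N)) (y : EuclideanSpace ℝ (Fin N)) : ℝ := (l.map fun i => y i).prod

theorem coordMonomial_cons (i : Fin N) (l : List (Fin N)) (y : EuclideanSpace ℝ (Fin N)) :
    coordMonomial (i :: l) y = y i * coordMonomial l y := by
  simp [coordMonomial]

theorem contDiff_coordMonomial {n : WithTop ℕ∞} (l : List (Fin N)) :
    ContDiff ℝ n (coordMonomial l) := by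
  induction l with
  | nil => exact contDiff_const
  | cons i l ih =>
    rw [funext (coordMonomial_cons i l)]
    exact (EuclideanSpace.proj (𝕜 := ℝ) i).contDiff.mul ih

theorem IsPosHomogeneous.coordMonomial_mul (hf : IsPosHomogeneous d f) (l : List (Fin N)) :
    IsPosHomogeneous (d + l.length) (fun y => coordMonomial l y * f y) := by
  induction l with
  | nil => simpa [coordMonomial] using hf
  | cons i l ih =>
    have := ih.coord_mul i
    simp only [coordMonomial_cons, List.length_cons, mul_assoc]
    push_cast
    rwa [← add_assoc]

theorem contDiffOn_iteratedPartialDeriv {n : ℕ} (l : List (Fin N))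
    (hf : ContDiffOn ℝ (n + l.length : ℕ) f {0}ᶜ) :
    ContDiffOn ℝ n (iteratedPartialDeriv l f) {0}ᶜ := by
  induction l generalizing n with
  | nil => simpa [iteratedPartialDeriv] using hf
  | cons i l ih =>
    refine contDiffOn_partialDeriv (n := n) ?_ i
    have : ContDiffOn ℝ ((n + 1 : ℕ) : WithTop ℕ∞) (iteratedPartialDeriv l f) {0}ᶜ :=
      ih (by rw [List.length_cons] at hf; convert hf using 2; omega)
    exact_mod_cast this

theorem differentiableAt_iteratedPartialDeriv {l : List (Fin N)} {k : ℕ} (hl : l.length + 1 ≤ k)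
    (hf : ContDiffOn ℝ k f {0}ᶜ) {y : EuclideanSpace ℝ (Fin N)} (hy : y ≠ 0) :
    DifferentiableAt ℝ (iteratedPartialDeriv l f) y :=
  (contDiffAt_of_contDiffOn_compl (contDiffOn_iteratedPartialDeriv (n := 1) l
    (hf.of_le (by exact_mod_cast (by omega)))) hy).differentiableAt (by simp)

theorem IsPosHomogeneous.iteratedPartialDeriv (l : List (Fin N))
    (hf : IsPosHomogeneous (d + l.length) f) (hd : ContDiffOn ℝ l.length f {0}ᶜ) :
    IsPosHomogeneous d (iteratedPartialDeriv l f) := by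
  induction l generalizing d with
  | nil => simpa [_root_.iteratedPartialDeriv] using hf
  | cons i l ih =>
    refine (ih (d := d + 1) ?_ (hd.of_le (by simp))).partialDeriv (fun y hy => ?_) i
    · rw [List.length_cons] at hf
      push_cast at hf
      rwa [add_right_comm, add_assoc]
    · exact differentiableAt_iteratedPartialDeriv (by simp) hd hy

/-- The lists obtained from a list by erasing one occurrence of `s`. -/
def erasures (s : Fin N) : List (Fin N) → List (List (Fin N))
  | [] => []
  | a :: l => (if a = s then [l] else []) ++ (erasures s l).map (a :: ·)

theorem length_of_mem_erasures {s : Fin N} {l l' : List (Fin N)} (h : l' ∈ erasures s l) :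
    l'.length + 1 = l.length := by
  induction l generalizing l' with
  | nil => simp [erasures] at h
  | cons a l ih =>
    simp only [erasures, List.mem_append, List.mem_map] at h
    rcases h with h | ⟨l'', h, rfl⟩
    · split_ifs at h
      · simp_all
      · simp at h
    · simp [ih h]

theorem sum_map_erasures_cons (s a : Fin N) (l : List (Fin N)) (φ : List (Fin N) → ℝ) :
    ((erasures s (a :: l)).map φ).sum =
      (if a = s then φ l else 0) + ((erasures s l).map fun l' => φ (a :: l')).sum := by
  simp only [erasures, List.map_append, List.sum_append, List.map_map]
  split_ifs <;> simp [Function.comp_def]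

theorem single_apply_eq_ite (s a : Fin N) (c : ℝ) :
    (EuclideanSpace.single s (1 : ℝ)) a * c = if a = s then c else 0 := by
  simp

/-- The Leibniz rule; `erasures` lists one term per occurrence of s, so multiplicities are correct.
The same lists index the commutator in `iteratedPartialDeriv_coord_mul`. -/
theorem partialDeriv_coordMonomial (s : Fin N) (l : List (Fin N)) (y : EuclideanSpace ℝ (Fin N)) :
    partialDeriv s (coordMonomial l) y =
      ((erasures s l).map fun l' => coordMonomial l' y).sum := by
  induction l with
  | nil =>
    have : coordMonomial ([] : List (Fin N)) = fun _ => 1 := rfl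
    simp [this, partialDeriv, erasures]
  | cons a l ih =>
    rw [sum_map_erasures_cons, funext (coordMonomial_cons a l), partialDeriv,
      fderiv_coord_mul ((contDiff_coordMonomial (n := 1) l).contDiffAt.differentiableAt one_ne_zero),
      ← partialDeriv, ih, single_apply_eq_ite]
    simp only [coordMonomial_cons, List.sum_map_mul_left]

theorem hasFDerivAt_list_sum {ι : Type*} {F : ι → EuclideanSpace ℝ (Fin N) → ℝ} {L : List ι}
    {y : EuclideanSpace ℝ (Fin N)} (h : ∀ i ∈ L, DifferentiableAt ℝ (F i) y) :
    HasFDerivAt (fun y => (L.map fun i => F i y).sum) (L.map fun i => fderiv ℝ (F i) y).sum y := by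
  induction L with
  | nil => simpa using hasFDerivAt_const (0 : ℝ) y
  | cons i L ih =>
    simp only [List.map_cons, List.sum_cons]
    exact (h i (by simp)).hasFDerivAt.add (ih fun j hj => h j (by simp [hj]))

/-- The commutator of an iterated partial derivative with the multiplication by a coordinate. -/
theorem iteratedPartialDeriv_coord_mul (s : Fin N) (l : List (Fin N))
    (hf : ContDiffOn ℝ l.length f {0}ᶜ) :
    EqOn (iteratedPartialDeriv l (fun y => y s * f y))
      (fun y => y s * iteratedPartialDeriv l f y +
        ((erasures s l).map fun l' => iteratedPartialDeriv l' f y).sum) {0}ᶜ := by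
  induction l with
  | nil =>
    intro y _
    simp [iteratedPartialDeriv, erasures]
  | cons a l ih =>
    intro y hy
    have h1 := partialDeriv_eqOn (ih (hf.of_le (by simp))) a hy
    rw [iteratedPartialDeriv, h1]
    have hd := differentiableAt_iteratedPartialDeriv (l := l) (by simp) hf hy
    have hs := hasFDerivAt_list_sum (F := fun l' => iteratedPartialDeriv l' f)
      (L := erasures s l) (y := y) fun l' hl' =>
        differentiableAt_iteratedPartialDeriv (by
          have := length_of_mem_erasures hl'
          simp only [List.length_cons]
          omega) hf hy
    have hm : DifferentiableAt ℝ (fun y => y s * iteratedPartialDeriv l f y) y :=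
      (EuclideanSpace.proj (𝕜 := ℝ) s).differentiableAt.mul hd
    have h2 : HasFDerivAt (fun y => y s * iteratedPartialDeriv l f y +
        ((erasures s l).map fun l' => iteratedPartialDeriv l' f y).sum) _ y :=
      hm.hasFDerivAt.add hs
    have happ : ∀ (L : List (List (Fin N))) (W : EuclideanSpace ℝ (Fin N)),
        (L.map fun l' => fderiv ℝ (iteratedPartialDeriv l' f) y).sum W =
          (L.map fun l' => fderiv ℝ (iteratedPartialDeriv l' f) y W).sum := by
      intro L W
      induction L with
      | nil => simp
      | cons _ _ ih => simp [ih]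
    beta_reduce
    rw [sum_map_erasures_cons, partialDeriv, h2.fderiv, _root_.add_apply, fderiv_coord_mul hd,
      single_apply_eq_ite, happ]
    simp only [iteratedPartialDeriv, partialDeriv, eq_comm (a := s)]
    ring

end Iterated

/-! ### The differentiation formula of arbitrary order. -/

section Radon

variable {m : ℕ} {g : EuclideanSpace ℝ (Fin (m + 1)) → ℝ} {Z : EuclideanSpace ℝ (Fin (m + 1))}

theorem extendedRadon_list_sum (hm : 1 ≤ m) {ι : Type*}
    {F : ι → EuclideanSpace ℝ (Fin (m + 1)) → ℝ} {L : List ι}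
    (h : ∀ i ∈ L, ContinuousOn (F i) {0}ᶜ) (hZ : Z ≠ 0) :
    ContinuousOn (fun y => (L.map fun i => F i y).sum) {0}ᶜ ∧
      extendedRadon m (fun y => (L.map fun i => F i y).sum) Z =
        (L.map fun i => extendedRadon m (F i) Z).sum := by
  induction L with
  | nil => exact ⟨by simpa using continuousOn_const, by simp [extendedRadon_eq _ hZ]⟩
  | cons i L ih =>
    obtain ⟨h1, h2⟩ := ih fun j hj => h j (by simp [hj])
    have hi := h i (by simp)
    simp only [List.map_cons, List.sum_cons]
    exact ⟨hi.add h1, by rw [extendedRadon_add hm hi h1 hZ, h2]⟩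

/-- The differentiation formula for the Radon transform, for lists of indices. -/
theorem coordMonomial_mul_iteratedPartialDeriv_extendedRadon (hm : 1 ≤ m) (k : ℕ)
    (hg : ContDiffOn ℝ k g {0}ᶜ) (hhom : IsPosHomogeneous (-m) g) (τ σ : List (Fin (m + 1)))
    (hτ : τ.length = k) (hσ : σ.length = k) (hZ : Z ≠ 0) :
    coordMonomial τ Z * iteratedPartialDeriv σ (extendedRadon m g) Z =
      (-1) ^ k * extendedRadon m (iteratedPartialDeriv τ fun y => coordMonomial σ y * g y) Z := by
  induction k generalizing τ σ Z with
  | zero =>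
    obtain rfl := List.length_eq_zero_iff.1 hτ
    obtain rfl := List.length_eq_zero_iff.1 hσ
    simp [iteratedPartialDeriv, coordMonomial]
  | succ k ih =>
    obtain ⟨t, τ, rfl⟩ := List.exists_cons_of_length_eq_add_one hτ
    obtain ⟨s, σ, rfl⟩ := List.exists_cons_of_length_eq_add_one hσ
    rw [List.length_cons, add_left_inj] at hτ hσ
    have hgk : ContDiffOn ℝ k g {0}ᶜ := hg.of_le (by simp)
    replace ih := fun τ hτ {Z} (hZ : Z ≠ 0) => ih (Z := Z) hgk τ σ hτ hσ hZ
    set F : EuclideanSpace ℝ (Fin (m + 1)) → ℝ := fun y => coordMonomial σ y * g y with hFdef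
    have hF : ContDiffOn ℝ (k + 1 : ℕ) F {0}ᶜ := (contDiff_coordMonomial σ).contDiffOn.mul hg
    set G := iteratedPartialDeriv τ F with hGdef
    have hG : ContDiffOn ℝ 1 G {0}ᶜ := by
      have := contDiffOn_iteratedPartialDeriv (n := 1) τ (f := F) (by rwa [hτ, add_comm 1 k])
      exact_mod_cast this
    -- The k factors of the monomial raise the degree by k and the k derivatives lower it again, so
    -- the first-order formula applies to G.
    have hGhom : IsPosHomogeneous (-m) G := by
      refine IsPosHomogeneous.iteratedPartialDeriv τ ?_ (hF.of_le (by rw [hτ]; simp))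
      rw [hτ, ← hσ]
      exact hhom.coordMonomial_mul σ
    set A := iteratedPartialDeriv σ (extendedRadon m g) with hAdef
    have hR : ContDiffOn ℝ (k + 1 : ℕ) (extendedRadon m g) {0}ᶜ :=
      contDiffOn_extendedRadon hm (k + 1) hg hhom
    have hA : DifferentiableAt ℝ A Z := differentiableAt_iteratedPartialDeriv (by omega) hR hZ
    have hprod : partialDeriv s (fun Z => coordMonomial τ Z * A Z) Z =
        ((erasures s τ).map fun l => coordMonomial l Z).sum * A Z +
          coordMonomial τ Z * partialDeriv s A Z := by
      have hτd : DifferentiableAt ℝ (coordMonomial τ) Z :=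
        (contDiff_coordMonomial (n := 1) τ).contDiffAt.differentiableAt one_ne_zero
      have : HasFDerivAt (fun Z => coordMonomial τ Z * A Z) _ Z :=
        hτd.hasFDerivAt.mul hA.hasFDerivAt
      rw [partialDeriv, this.fderiv, ← partialDeriv_coordMonomial]
      simp [partialDeriv]
      ring
    -- The formula of order k holds at every nonzero point, hence may be differentiated.
    have hRG : partialDeriv s (fun Z => coordMonomial τ Z * A Z) Z =
        (-1) ^ k * partialDeriv s (extendedRadon m G) Z := by
      rw [partialDeriv_eqOn (fun Z hZ => ih τ hτ hZ) s hZ]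
      obtain ⟨L, hL, -⟩ := exists_hasFDerivAt_extendedRadon hm hG hZ
      rw [partialDeriv, (hL.const_mul _).fderiv, partialDeriv, hL.fderiv]
      rfl
    have hfirst := coord_mul_partialDeriv_extendedRadon hm hG hGhom hZ t s
    have hlen : ∀ l ∈ erasures s τ, (t :: l).length = k := fun l hl => by
      rw [List.length_cons, length_of_mem_erasures hl, hτ]
    -- Erasing s from τ and prepending t restores length k, so the induction hypothesis applies to
    -- each Leibniz term with the same σ.
    have hlow : Z t * (((erasures s τ).map fun l => coordMonomial l Z).sum * A Z) =
        (-1) ^ k * ((erasures s τ).map fun l =>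
          extendedRadon m (iteratedPartialDeriv (t :: l) F) Z).sum := by
      rw [← List.sum_map_mul_right, ← List.sum_map_mul_left, ← List.sum_map_mul_left]
      refine congrArg List.sum (List.map_congr_left fun l hl => ?_)
      rw [← ih (t :: l) (hlen l hl) hZ, coordMonomial_cons, mul_assoc]
    have hcons : (fun y => coordMonomial (s :: σ) y * g y) = fun y => y s * F y := by
      funext y
      rw [coordMonomial_cons, mul_assoc]
    have hcomm : EqOn (iteratedPartialDeriv (t :: τ) fun y => y s * F y)
        (fun y => partialDeriv t (fun y => y s * G y) y +
          ((erasures s τ).map fun l => iteratedPartialDeriv (t :: l) F y).sum) {0}ᶜ := by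
      intro y hy
      have hFτ : ContDiffOn ℝ (t :: τ).length F {0}ᶜ := by rwa [List.length_cons, hτ]
      have hGy : DifferentiableAt ℝ G y :=
        (contDiffAt_of_contDiffOn_compl hG hy).differentiableAt one_ne_zero
      rw [iteratedPartialDeriv_coord_mul s _ hFτ hy]
      beta_reduce
      rw [sum_map_erasures_cons, partialDeriv,
        fderiv_coord_mul hGy, single_apply_eq_ite]
      simp only [iteratedPartialDeriv, partialDeriv, eq_comm (a := s), hGdef]
      ring
    obtain ⟨hc, hsum⟩ := extendedRadon_list_sum hm (L := erasures s τ)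
      (F := fun l => iteratedPartialDeriv (t :: l) F) (fun l hl =>
        (contDiffOn_iteratedPartialDeriv (n := 0) (t :: l)
          (hF.of_le (by rw [hlen l hl]; simp))).continuousOn) hZ
    have hcG : ContinuousOn (partialDeriv t fun y => y s * G y) {0}ᶜ :=
      (contDiffOn_partialDeriv (n := 0) (by simpa using contDiffOn_coord_mul hG s) t).continuousOn
    rw [hcons, extendedRadon_congr hcomm hZ, extendedRadon_add hm hcG hc hZ, hsum,
      coordMonomial_cons, iteratedPartialDeriv, ← hAdef, pow_succ]
    -- The Leibniz terms in `hlow` account for the commutator sum, and `hfirst` supplies the extra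
    -- sign.
    linear_combination Z t * hRG - Z t * hprod - hlow + (-1) ^ k * hfirst

end Radon

end RadonAux

theorem theorem3p6 (m : ℕ) (hm : 1 ≤ m) (k : ℕ) (g : EuclideanSpace ℝ (Fin (m + 1)) → ℝ)
    (hg : ContDiffOn ℝ k g {0}ᶜ)
    (hhom : ∀ t : ℝ, 0 < t → ∀ y : EuclideanSpace ℝ (Fin (m + 1)), y ≠ 0 →
      g (t • y) = t ^ (-(m : ℤ)) * g y) :
    ContDiffOn ℝ k (extendedRadon m g) {0}ᶜ ∧
      ∀ (τ σ : Fin k → Fin (m + 1)) (Z : EuclideanSpace ℝ (Fin (m + 1))), Z ≠ 0 →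
        (∏ i, Z (τ i)) * iteratedPartialDeriv (List.ofFn σ) (extendedRadon m g) Z =
          (-1) ^ k * extendedRadon m
            (iteratedPartialDeriv (List.ofFn τ) (fun y => (∏ i, y (σ i)) * g y)) Z := by
  refine ⟨contDiffOn_extendedRadon hm k hg hhom, fun τ σ Z hZ => ?_⟩
  have hprod : ∀ (ρ : Fin k → Fin (m + 1)) (y : EuclideanSpace ℝ (Fin (m + 1))),
      coordMonomial (List.ofFn ρ) y = ∏ i, y (ρ i) := by
    intro ρ y
    rw [coordMonomial, List.map_ofFn, List.prod_ofFn]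
    rfl
  simpa only [hprod] using coordMonomial_mul_iteratedPartialDeriv_extendedRadon hm k hg hhom
    (List.ofFn τ) (List.ofFn σ) List.length_ofFn List.length_ofFn hZ
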